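/- Let $V:\mathbb{R}\to\mathbb{R}$ be bounded and continuous with $V\ge 0$ and $0<\int_{\mathbb{R}}|x|V(x)\,dx<\infty$. Let $\psi_1$ be the (unique) nondecreasing solution and $\psi_2$ the (unique) nonincreasing solution of $-\psi''+V\psi=0$ on $\mathbb{R}$ satisfying $$\lim_{x\to-\infty}\big(\psi_1(x),x\psi_1'(x)\big)=(1,0),\qquad \lim_{x\to+\infty}\big(\psi_2(x),x\psi_2'(x)\big)=(1,0),$$ and put $\psi_V=\psi_1+\psi_2$ and $d\mu_V=\psi_V(x)\,dx$. Let $S=-\frac{d^2}{dx^2}+V$ with domain $D(S)=H^2(\mathbb{R})$ in the real Hilbert space $L^2(\mathbb{R})$, and let $S^{1/2}$ be its nonnegative self-adjoint square root. Then there exists a constant $C^*>0$ such that for every $f\in D(S^{1/2})\cap L^1(\mathbb{R},d\mu_V)$, $$\|\psi_V^{2/3}f\|_{L^2(\mathbb{R})}^6\le C^*\,\|\psi_Vf\|_{L^1(\mathbb{R})}^4\,\|S^{1/2}f\|_{L^2(\mathbb{R})}^2 ;$$ in particular the left-hand side is finite. -/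

import Mathlib

open MeasureTheory Filter Topology
open scoped ENNReal ContDiff BoundedContinuousFunction

noncomputable section

namespace SchrodingerNash

/-- The real Hilbert space `L²(ℝ)` with respect to Lebesgue measure. -/
abbrev L2 : Type := Lp ℝ 2 (volume : Measure ℝ)

/-- `g` is a weak derivative of `f`: `∫ f φ' = - ∫ g φ` for all test functions `φ ∈ C_c^∞(ℝ)`. -/
def HasWeakDeriv (f g : L2) : Prop :=
  ∀ φ : ℝ → ℝ, ContDiff ℝ ∞ φ → HasCompactSupport φ →
    ∫ x, f x * deriv φ x = - ∫ x, g x * φ x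

lemma integrable_mul_test (f : L2) {φ : ℝ → ℝ} (hφ : Continuous φ) (hc : HasCompactSupport φ) :
    Integrable (fun x => f x * φ x) :=
  (Lp.memLp f).integrable_mul (q := 2) (hφ.memLp_of_hasCompactSupport hc)

lemma integral_zero_mul (ψ : ℝ → ℝ) : ∫ x, (0 : L2) x * ψ x = 0 := by
  rw [← integral_zero ℝ ℝ]
  apply integral_congr_ae
  filter_upwards [Lp.coeFn_zero ℝ 2 (volume : Measure ℝ)] with x hx
  rw [hx, Pi.zero_apply, zero_mul]

lemma HasWeakDeriv.zero : HasWeakDeriv 0 0 := by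
  intro φ _ _
  rw [integral_zero_mul, integral_zero_mul, neg_zero]

lemma HasWeakDeriv.add {f₁ g₁ f₂ g₂ : L2} (h₁ : HasWeakDeriv f₁ g₁) (h₂ : HasWeakDeriv f₂ g₂) :
    HasWeakDeriv (f₁ + f₂) (g₁ + g₂) := by
  intro φ hφ hc
  have key : ∀ (a b : L2) (ψ : ℝ → ℝ), Continuous ψ → HasCompactSupport ψ →
      ∫ x, (a + b : L2) x * ψ x = (∫ x, a x * ψ x) + ∫ x, b x * ψ x := by
    intro a b ψ h1 h2
    rw [← integral_add (integrable_mul_test a h1 h2) (integrable_mul_test b h1 h2)]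
    apply integral_congr_ae
    filter_upwards [Lp.coeFn_add a b] with x hx
    rw [hx, Pi.add_apply, add_mul]
  rw [key _ _ _ (hφ.continuous_deriv (by simp)) hc.deriv, key _ _ _ hφ.continuous hc,
    h₁ φ hφ hc, h₂ φ hφ hc]
  ring

lemma HasWeakDeriv.smul {f g : L2} (c : ℝ) (h : HasWeakDeriv f g) :
    HasWeakDeriv (c • f) (c • g) := by
  intro φ hφ hc
  have key : ∀ (a : L2) (ψ : ℝ → ℝ), ∫ x, (c • a : L2) x * ψ x = c * ∫ x, a x * ψ x := by
    intro a ψ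
    rw [← integral_const_mul]
    apply integral_congr_ae
    filter_upwards [Lp.coeFn_smul c a] with x hx
    rw [hx, Pi.smul_apply, smul_eq_mul, mul_assoc]
  rw [key, key, h φ hφ hc]
  ring

/-- A weak derivative of `0` vanishes, i.e. weak derivatives are unique. -/
lemma HasWeakDeriv.eq_zero {g : L2} (h : HasWeakDeriv 0 g) : g = 0 := by
  rw [Lp.eq_zero_iff_ae_eq_zero]
  apply ae_eq_zero_of_integral_contDiff_smul_eq_zero
    ((Lp.memLp g).locallyIntegrable (by norm_num))
  intro φ hφ hc
  have := h φ hφ hc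
  rw [integral_zero_mul] at this
  simp only [smul_eq_mul, mul_comm (φ _)]
  linarith

/-- The graph of the weak derivative in `L²(ℝ)`. -/
def weakDerivGraph : Submodule ℝ (L2 × L2) where
  carrier := {p | HasWeakDeriv p.1 p.2}
  zero_mem' := HasWeakDeriv.zero
  add_mem' h₁ h₂ := h₁.add h₂
  smul_mem' c _ h := h.smul c

/-- The weak derivative `d/dx` as an unbounded operator in `L²(ℝ)`; its domain is `H¹(ℝ)`, the
space of all `f ∈ L²(ℝ)` that have a weak derivative in `L²(ℝ)`. -/
def weakDeriv : L2 →ₗ.[ℝ] L2 := weakDerivGraph.toLinearPMap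

/-- `weakDeriv f = g` holds exactly if `g` is a weak derivative of `f`. -/
lemma mem_graph_weakDeriv (f g : L2) : (f, g) ∈ weakDeriv.graph ↔ HasWeakDeriv f g := by
  have hg : ∀ p : L2 × L2, p ∈ weakDerivGraph → p.1 = 0 → p.2 = 0 := by
    rintro ⟨a, b⟩ hp rfl
    exact HasWeakDeriv.eq_zero hp
  rw [weakDeriv, Submodule.toLinearPMap_graph_eq _ hg]
  rfl

/-- The composition `B A` of unbounded operators with its natural domain
`{x ∈ D(A) | A x ∈ D(B)}`. -/
def pcomp {H : Type*} [AddCommGroup H] [Module ℝ H] (B A : H →ₗ.[ℝ] H) : H →ₗ.[ℝ] H where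
  domain := (B.domain.comap A.toFun).map A.domain.subtype
  toFun :=
    { toFun := fun x =>
        B ⟨A ⟨x, by obtain ⟨y, -, hy⟩ := x.2; rw [← hy]; exact y.2⟩, by
          obtain ⟨x, y, hy, rfl⟩ := x; exact hy⟩
      map_add' := fun x y => by
        rw [← LinearPMap.map_add]; congr 1; ext1
        exact LinearPMap.map_add A ⟨x, _⟩ ⟨y, _⟩
      map_smul' := fun c x => by
        rw [RingHom.id_apply, ← LinearPMap.map_smul]; congr 1; ext1
        exact LinearPMap.map_smul A c ⟨x, _⟩ }

lemma mem_pcomp_domain {H : Type*} [AddCommGroup H] [Module ℝ H] {B A : H →ₗ.[ℝ] H} {x : H} :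
    x ∈ (pcomp B A).domain ↔ ∃ hx : x ∈ A.domain, A ⟨x, hx⟩ ∈ B.domain := by
  constructor
  · rintro ⟨y, hy, rfl⟩
    exact ⟨y.2, hy⟩
  · rintro ⟨hx, h⟩
    exact ⟨⟨x, hx⟩, h, rfl⟩

/-- Multiplication by a bounded continuous function as a linear operator on `L²(ℝ)`. -/
def mulOp (V : ℝ →ᵇ ℝ) : L2 →ₗ[ℝ] L2 where
  toFun f := MemLp.toLp (fun x => V x * f x)
    ((Lp.memLp f).of_le_mul (c := ‖V‖)
      (V.continuous.aestronglyMeasurable.mul (Lp.aestronglyMeasurable f))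
      (Eventually.of_forall fun x => by
        rw [norm_mul]; gcongr; exact V.norm_coe_le_norm x))
  map_add' f g := by
    rw [← MemLp.toLp_add]
    apply MemLp.toLp_congr
    filter_upwards [Lp.coeFn_add f g] with x hx
    rw [hx, Pi.add_apply, Pi.add_apply, mul_add]
  map_smul' c f := by
    rw [RingHom.id_apply, ← MemLp.toLp_const_smul]
    apply MemLp.toLp_congr
    filter_upwards [Lp.coeFn_smul c f] with x hx
    rw [hx, Pi.smul_apply, Pi.smul_apply, smul_eq_mul, smul_eq_mul]
    ring

/-- The Schrödinger operator `S = -d²/dx² + V` in `L²(ℝ)`, with domain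
`H²(ℝ) = {f ∈ H¹(ℝ) | f' ∈ H¹(ℝ)}`. -/
def schrodinger (V : ℝ →ᵇ ℝ) : L2 →ₗ.[ℝ] L2 where
  domain := (pcomp weakDeriv weakDeriv).domain
  toFun := -(pcomp weakDeriv weakDeriv).toFun +
    (mulOp V).comp (pcomp weakDeriv weakDeriv).domain.subtype

/-- `T` is the square root `A^{1/2}` of the unbounded operator `A` in a real Hilbert space: `T` is
self-adjoint and nonnegative, and `T² = A` (including equality of domains). A nonnegative
self-adjoint operator `A` has exactly one such square root. -/
structure IsNonnegSqrt {H : Type*} [NormedAddCommGroup H] [InnerProductSpace ℝ H]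
    [CompleteSpace H] (A T : H →ₗ.[ℝ] H) : Prop where
  isSelfAdjoint : IsSelfAdjoint T
  nonneg : ∀ f : T.domain, 0 ≤ inner ℝ (T f) (f : H)
  sq_eq : pcomp T T = A

/-- The class of potentials: `V` is bounded and continuous (this is in the type), nonnegative, and
`0 < ∫ |x| V(x) dx < ∞`. -/
structure IsAdmissible (V : ℝ →ᵇ ℝ) : Prop where
  nonneg : ∀ x, 0 ≤ V x
  integrable : Integrable (fun x : ℝ => |x| * V x)
  integral_pos : 0 < ∫ x : ℝ, |x| * V x

/-- `ψ` is a (classical) solution of `-ψ'' + V ψ = 0` on `ℝ`. -/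
def IsHarmonic (V ψ : ℝ → ℝ) : Prop :=
  ContDiff ℝ 2 ψ ∧ ∀ x, - deriv (deriv ψ) x + V x * ψ x = 0

/-- `ψ₁`: the increasing solution of `-ψ'' + V ψ = 0` normalized by `(ψ(x), x ψ'(x)) → (1, 0)` as
`x → -∞`; for an admissible potential `V` there is exactly one. -/
structure IsLeftSolution (V ψ : ℝ → ℝ) : Prop where
  harmonic : IsHarmonic V ψ
  monotone : Monotone ψ
  tendsto : Tendsto (fun x => (ψ x, x * deriv ψ x)) atBot (𝓝 (1, 0))

/-- `ψ₂`: the decreasing solution of `-ψ'' + V ψ = 0` normalized by `(ψ(x), x ψ'(x)) → (1, 0)` as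
`x → +∞`; for an admissible potential `V` there is exactly one. -/
structure IsRightSolution (V ψ : ℝ → ℝ) : Prop where
  harmonic : IsHarmonic V ψ
  antitone : Antitone ψ
  tendsto : Tendsto (fun x => (ψ x, x * deriv ψ x)) atTop (𝓝 (1, 0))

/-- The measure `dμ = ψ(x) dx` for a nonnegative weight `ψ`. -/
def weightedMeasure (ψ : ℝ → ℝ) : Measure ℝ :=
  volume.withDensity fun x => ENNReal.ofReal (ψ x)

end SchrodingerNash

end

namespace SchrodingerNash

/-! Write `ψ` for the weight: it is convex, at least `1`, and solves `ψ'' = Vψ`. The ground state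
representation gives `∫ ψ² |(u/ψ)'|² ≤ ⟨Su, u⟩` for `u ∈ H²(ℝ)`
(`IsHarmonicWeight.integral_sq_le_inner`). By convexity, `ψ ≥ ψ(x)` on one of the two half-lines
ending at `x`. Integrating the derivative of `|g|^(3/2)`, `g = u/ψ`, along that half-line and using
Cauchy-Schwarz, `ψ(x)² |g(x)|^(3/2) ≤ 3/2 ∫ ψ² |g|^(1/2) |g'| ≤ 3/2 (∫ ψ|u|)^(1/2) (∫ ψ²
|g'|²)^(1/2)`. The square of this is the sup bound `ψ|u|³ ≤ 9/4 ‖ψu‖₁ ‖S^{1/2}u‖²`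
(`IsHarmonicWeight.ae_mul_abs_pow_le`). Integrating `ψ^(4/3) u² = (ψ|u|³)^(1/3) · ψ|u|` and cubing
yields the theorem with constant `9/4` (`eLpNorm_two_pow_six_le`).

The passage from `D(S)` to `D(S^{1/2})` rests on `D(T²)` being a core of `T = S^{1/2}`
(`exists_seq_tendsto_of_isSelfAdjoint`). The approximants need not lie in the weighted `L¹` space,
so limits are taken on bounded intervals, and the half-line is reached afterwards using that `f ∈
L²` is small at suitable far points. -/

/-! ### Primitives and weak derivatives on the line -/

lemma absolutelyContinuousOnInterval_const_add_integral {h : ℝ → ℝ}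
    (hh : ∀ a b, IntervalIntegrable h volume a b) (c d a b : ℝ) :
    AbsolutelyContinuousOnInterval (fun x => c + ∫ t in d..x, h t) a b := by
  have h0 : AbsolutelyContinuousOnInterval (fun x => ∫ t in a..x, h t) a b :=
    (hh a b).absolutelyContinuousOnInterval_intervalIntegral (by simp)
  have hc : AbsolutelyContinuousOnInterval (fun _ : ℝ => c + ∫ t in d..a, h t) a b :=
    ((LipschitzWith.const _).lipschitzOnWith (s := Set.uIcc a b)).absolutelyContinuousOnInterval
  have e : (fun x => c + ∫ t in d..x, h t)
      = (fun _ : ℝ => c + ∫ t in d..a, h t) + fun x => ∫ t in a..x, h t := by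
    funext x
    rw [Pi.add_apply, add_assoc, intervalIntegral.integral_add_adjacent_intervals (hh d a) (hh a x)]
  rw [e]
  exact hc.add h0

lemma ae_deriv_const_add_integral {h : ℝ → ℝ}
    (hh : ∀ a b, IntervalIntegrable h volume a b) (c a b : ℝ) :
    ∀ᵐ x, x ∈ Set.uIcc a b → deriv (fun x => c + ∫ t in a..x, h t) x = h x := by
  filter_upwards [(hh a b).ae_hasDerivAt_integral] with x hx hxm
  exact ((hx hxm a (by simp)).const_add c).deriv

/-- Integration by parts for a primitive of a locally integrable function and a `C¹` function. -/
lemma integral_mul_eq_of_primitive {h K k : ℝ → ℝ}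
    (hh : ∀ a b, IntervalIntegrable h volume a b) (hK : ∀ x, HasDerivAt K (k x) x)
    (hk : Continuous k) {H : ℝ → ℝ} {c d : ℝ} (hH : ∀ x, H x = c + ∫ t in d..x, h t) (a b : ℝ) :
    ∫ x in a..b, H x * k x = H b * K b - H a * K a - ∫ x in a..b, h x * K x := by
  have hH' : H = fun x => H a + ∫ t in a..x, h t := by
    ext x
    rw [hH x, hH a, add_assoc, intervalIntegral.integral_add_adjacent_intervals (hh d a) (hh a x)]
  have hK' : K = fun x => K a + ∫ t in a..x, k t := by
    ext x
    rw [intervalIntegral.integral_eq_sub_of_hasDerivAt (fun y _ => hK y)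
      (hk.intervalIntegrable a x)]
    ring
  have acH : AbsolutelyContinuousOnInterval H a b := by
    rw [hH']; exact absolutelyContinuousOnInterval_const_add_integral hh _ _ _ _
  have acK : AbsolutelyContinuousOnInterval K a b := by
    rw [hK']
    exact absolutelyContinuousOnInterval_const_add_integral
      (fun a b => hk.intervalIntegrable a b) _ _ _ _
  have key := acH.integral_mul_deriv_eq_deriv_mul acK
  have e1 : (fun x => H x * deriv K x) = fun x => H x * k x := by
    ext x; rw [(hK x).deriv]
  have e2 : ∫ x in a..b, deriv H x * K x = ∫ x in a..b, h x * K x := by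
    apply intervalIntegral.integral_congr_ae
    have := ae_deriv_const_add_integral hh (H a) a b
    rw [← hH'] at this
    filter_upwards [this] with x hx hxm
    rw [hx (Set.uIoc_subset_uIcc hxm)]
  rw [e1, e2] at key
  exact key

lemma L2.intervalIntegrable (f : L2) (a b : ℝ) : IntervalIntegrable f volume a b :=
  ((Lp.memLp f).locallyIntegrable (by norm_num)).integrableOn_isCompact
    isCompact_uIcc |>.intervalIntegrable

/-- The derivative of a compactly supported primitive of a test function of integral zero. -/
lemma exists_primitive_test {η : ℝ → ℝ} (hη : ContDiff ℝ ∞ η) (hc : HasCompactSupport η)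
    (h0 : ∫ x, η x = 0) :
    ∃ φ : ℝ → ℝ, ContDiff ℝ ∞ φ ∧ HasCompactSupport φ ∧ ∀ x, HasDerivAt φ (η x) x := by
  obtain ⟨R, hR⟩ := (hc.isCompact.isBounded).subset_closedBall 0
  have hz : ∀ x, R < |x| → η x = 0 := fun x hx => by
    by_contra hne
    have := hR (subset_tsupport η hne)
    rw [Metric.mem_closedBall, dist_zero_right, Real.norm_eq_abs] at this
    linarith
  -- `R` may be negative when the support is empty. The margin `1` keeps the support away from the
  -- endpoint `-S`, which `Ioc` excludes.
  let S := |R| + 1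
  have hS : R < S := by have := le_abs_self R; simp only [S]; linarith
  have hSp : 0 < S := by positivity
  have hint : ∀ a b, IntervalIntegrable η volume a b :=
    fun a b => hη.continuous.intervalIntegrable a b
  have hder : ∀ x, HasDerivAt (fun x => ∫ t in (-S)..x, η t) (η x) x := fun x =>
    intervalIntegral.integral_hasDerivAt_right (hint _ _)
      hη.continuous.stronglyMeasurable.stronglyMeasurableAtFilter hη.continuous.continuousAt
  have htot : ∫ t in (-S)..S, η t = 0 := by
    rw [intervalIntegral.integral_eq_integral_of_support_subset, h0]
    intro x hx
    have : ¬ R < |x| := fun h => hx (hz x h)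
    have h2 := abs_lt.1 (lt_of_le_of_lt (not_lt.1 this) hS)
    exact ⟨h2.1, h2.2.le⟩
  refine ⟨fun x => ∫ t in (-S)..x, η t, ?_, ?_, hder⟩
  · rw [contDiff_infty_iff_deriv]
    refine ⟨fun x => (hder x).differentiableAt, ?_⟩
    rwa [show deriv (fun x => ∫ t in (-S)..x, η t) = η from funext fun x => (hder x).deriv]
  · apply HasCompactSupport.of_support_subset_isCompact (isCompact_Icc (a := -S) (b := S))
    intro x hx
    by_contra hne
    apply hx
    rw [Set.mem_Icc, not_and_or, not_le, not_le] at hne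
    rcases hne with h | h
    · apply intervalIntegral.integral_zero_ae
      refine Eventually.of_forall fun t ht => hz t ?_
      rw [Set.uIoc_of_ge h.le] at ht
      have := neg_le_abs t
      linarith [ht.2]
    · simp only
      rw [← intervalIntegral.integral_add_adjacent_intervals (hint (-S) S) (hint S x), htot,
        zero_add]
      apply intervalIntegral.integral_zero_ae
      refine Eventually.of_forall fun t ht => hz t ?_
      rw [Set.uIoc_of_le h.le] at ht
      have := le_abs_self t
      linarith [ht.1]

/-- The du Bois-Reymond lemma: a locally integrable function with vanishing weak derivative is
almost everywhere constant. -/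
lemma ae_eq_const_of_integral_mul_deriv_eq_zero {F : ℝ → ℝ} (hF : LocallyIntegrable F)
    (h : ∀ φ : ℝ → ℝ, ContDiff ℝ ∞ φ → HasCompactSupport φ → ∫ x, F x * deriv φ x = 0) :
    ∃ c, F =ᵐ[volume] fun _ => c := by
  let b : ContDiffBump (0 : ℝ) := ⟨1, 2, by norm_num, by norm_num⟩
  let ρ : ℝ → ℝ := b.normed volume
  have hρ : ContDiff ℝ ∞ ρ := b.contDiff_normed
  have hρc : HasCompactSupport ρ := b.hasCompactSupport_normed
  have hρ1 : ∫ x, ρ x = 1 := b.integral_normed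
  have hFi : ∀ η : ℝ → ℝ, ContDiff ℝ ∞ η → HasCompactSupport η →
      Integrable fun x => F x * η x := fun η h1 h2 => by
    simpa only [smul_eq_mul, mul_comm] using
      hF.integrable_smul_left_of_hasCompactSupport h1.continuous h2
  refine ⟨∫ x, F x * ρ x, ?_⟩
  set c := ∫ x, F x * ρ x with hcdef
  have : ∀ᵐ x, F x - c = 0 := by
    apply ae_eq_zero_of_integral_contDiff_smul_eq_zero (hF.sub (locallyIntegrable_const c))
    intro η hη hηc
    have hηi : Integrable η := hη.continuous.integrable_of_hasCompactSupport hηc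
    have hρi : Integrable ρ := hρ.continuous.integrable_of_hasCompactSupport hρc
    -- Subtracting a multiple of `ρ`, which has mass one, makes the integral vanish, so the
    -- difference is the derivative of a test function. Testing `F` against it gives `∫ F η = c ∫
    -- η`.
    obtain ⟨φ, hφ, hφc, hd⟩ := exists_primitive_test (η := fun x => η x - (∫ y, η y) * ρ x)
      (hη.sub (contDiff_const.mul hρ)) (hηc.sub (hρc.mul_left (f := fun _ => ∫ y, η y)))
      (by rw [integral_sub hηi (hρi.const_mul _), integral_const_mul, hρ1]; ring)
    have h0 := h φ hφ hφc
    rw [show deriv φ = fun x => η x - (∫ y, η y) * ρ x from funext fun x => (hd x).deriv] at h0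
    have e : ∀ x, F x * (η x - (∫ y, η y) * ρ x) = F x * η x - (∫ y, η y) * (F x * ρ x) :=
      fun x => by ring
    simp only [e] at h0
    rw [integral_sub (hFi η hη hηc) ((hFi ρ hρ hρc).const_mul _), integral_const_mul] at h0
    have e2 : ∀ x, η x • (F x - c) = F x * η x - c * η x := fun x => by
      rw [smul_eq_mul]; ring
    simp only [Pi.sub_apply, e2]
    rw [integral_sub (hFi η hη hηc) (hηi.const_mul _), integral_const_mul]
    linarith
  filter_upwards [this] with x hx
  linarith

/-- A function in `H¹(ℝ)` is a primitive of its weak derivative. -/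
lemma HasWeakDeriv.ae_eq_primitive {f g : L2} (h : HasWeakDeriv f g) :
    ∃ c : ℝ, f =ᵐ[volume] fun x => c + ∫ t in (0 : ℝ)..x, g t := by
  have hg := L2.intervalIntegrable g
  have hGc : Continuous fun x => ∫ t in (0 : ℝ)..x, g t :=
    intervalIntegral.continuous_primitive hg 0
  have hfl : LocallyIntegrable f := (Lp.memLp f).locallyIntegrable (by norm_num)
  obtain ⟨c, hc⟩ := ae_eq_const_of_integral_mul_deriv_eq_zero
    (F := fun x => f x - ∫ t in (0 : ℝ)..x, g t) (hfl.sub hGc.locallyIntegrable) (by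
      intro φ hφ hφc
      have hd : Continuous (deriv φ) := hφ.continuous_deriv (by simp)
      have e : ∀ x, (f x - ∫ t in (0 : ℝ)..x, g t) * deriv φ x
        = f x * deriv φ x - (∫ t in (0 : ℝ)..x, g t) * deriv φ x := fun x => by ring
      simp only [e]
      have hGi : Integrable fun x => (∫ t in (0 : ℝ)..x, g t) * deriv φ x :=
        (hGc.mul hd).integrable_of_hasCompactSupport hφc.deriv.mul_left
      rw [integral_sub (integrable_mul_test f hd hφc.deriv) hGi, h φ hφ hφc]
      obtain ⟨R, hR⟩ := (hφc.isCompact.isBounded).subset_closedBall 0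
      have hz : ∀ x, R < |x| → φ x = 0 := fun x hx => by
        by_contra hne
        have := hR (subset_tsupport φ hne)
        rw [Metric.mem_closedBall, dist_zero_right, Real.norm_eq_abs] at this
        linarith
      have hz' : ∀ x, R < |x| → deriv φ x = 0 := fun x hx => by
        by_contra hne
        have := hR (tsupport_deriv_subset (subset_tsupport _ hne))
        rw [Metric.mem_closedBall, dist_zero_right, Real.norm_eq_abs] at this
        linarith
      let S := |R| + 1
      have hS : R < S := by have := le_abs_self R; simp only [S]; linarith
      have hSp : 0 < S := by positivity
      have hsub : ∀ ψ : ℝ → ℝ, (∀ x, R < |x| → ψ x = 0) →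
          Function.support ψ ⊆ Set.Ioc (-S) S := fun ψ hψ x hx => by
        have : ¬ R < |x| := fun h => hx (hψ x h)
        have h2 := abs_lt.1 (lt_of_le_of_lt (not_lt.1 this) hS)
        exact ⟨h2.1, h2.2.le⟩
      -- The primitive of `g` also has weak derivative `g`: the boundary terms vanish because `φ` is
      -- zero at `±S`.
      have key := integral_mul_eq_of_primitive hg
        (fun x => ((hφ.differentiable (by simp)) x).hasDerivAt) hd
        (H := fun x => ∫ t in (0 : ℝ)..x, g t) (c := 0) (d := 0) (fun x => by simp) (-S) S
      rw [hz S (by rwa [abs_of_pos hSp]), hz (-S) (by rwa [abs_neg, abs_of_pos hSp]),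
        intervalIntegral.integral_eq_integral_of_support_subset
          (hsub _ fun x hx => by simp [hz' x hx]),
        intervalIntegral.integral_eq_integral_of_support_subset
          (hsub _ fun x hx => by simp [hz x hx])] at key
      linarith)
  refine ⟨c, ?_⟩
  filter_upwards [hc] with x hx
  linarith

/-! ### Self-adjoint operators and the core `D(T²)` -/

section SelfAdjoint

variable {H : Type*} [NormedAddCommGroup H] [InnerProductSpace ℝ H]
  {T : H →ₗ.[ℝ] H}

/-- The graph of a linear operator as a subspace of the Hilbert sum `H ⊕ H`. -/
def hilbertGraph (T : H →ₗ.[ℝ] H) : Submodule ℝ (WithLp 2 (H × H)) :=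
  T.graph.comap (WithLp.linearEquiv 2 ℝ (H × H)).toLinearMap

lemma mem_hilbertGraph {p : WithLp 2 (H × H)} :
    p ∈ hilbertGraph T ↔ ∃ h : p.fst ∈ T.domain, T ⟨p.fst, h⟩ = p.snd := by
  change (p.fst, p.snd) ∈ T.graph ↔ _
  rw [LinearPMap.mem_graph_iff]
  constructor
  · rintro ⟨z, hz1, hz2⟩
    simp only at hz1 hz2
    have : p.fst ∈ T.domain := hz1 ▸ z.2
    exact ⟨this, by rw [← hz2]; congr 1; exact Subtype.ext hz1.symm⟩
  · rintro ⟨h, h2⟩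
    exact ⟨⟨p.fst, h⟩, rfl, h2⟩

variable [CompleteSpace H]

lemma inner_apply_eq_of_isSelfAdjoint (hT : IsSelfAdjoint T) (x y : T.domain) :
    inner ℝ (T x) (y : H) = inner ℝ (x : H) (T y) := by
  have h := T.adjoint_isFormalAdjoint hT.dense_domain
  rw [LinearPMap.isSelfAdjoint_def.1 hT] at h
  exact h x y

/-- The hypothesis places `y` in the domain of the adjoint with value `w`, and the adjoint is `T`
itself. -/
lemma mem_domain_of_isSelfAdjoint (hT : IsSelfAdjoint T) {y w : H}
    (h : ∀ x : T.domain, inner ℝ w (x : H) = inner ℝ y (T x)) :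
    ∃ hy : y ∈ T.domain, T ⟨y, hy⟩ = w := by
  have hd := hT.dense_domain
  have h1 : y ∈ T.adjoint.domain := LinearPMap.mem_adjoint_domain_of_exists y ⟨w, h⟩
  have h2 : T.adjoint ⟨y, h1⟩ = w := LinearPMap.adjoint_apply_eq hd ⟨y, h1⟩ h
  have h3 : (y, w) ∈ T.adjoint.graph := by
    rw [← h2]; exact LinearPMap.mem_graph _ ⟨y, h1⟩
  rw [LinearPMap.isSelfAdjoint_def.1 hT, LinearPMap.mem_graph_iff] at h3
  obtain ⟨z, hz1, hz2⟩ := h3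
  simp only at hz1 hz2
  subst hz1
  exact ⟨z.2, hz2⟩

lemma isClosed_hilbertGraph (hT : IsSelfAdjoint T) :
    IsClosed (hilbertGraph T : Set (WithLp 2 (H × H))) :=
  hT.isClosed.preimage (WithLp.prod_continuous_ofLp 2 H H)

/-- For a self-adjoint operator `T`, the operator `1 + T²` is onto. -/
lemma exists_add_apply_apply_eq (hT : IsSelfAdjoint T) (h : H) :
    ∃ (v : T.domain) (hv : T v ∈ T.domain), (v : H) + T ⟨T v, hv⟩ = h := by
  have : CompleteSpace (hilbertGraph T) :=
    (isClosed_hilbertGraph hT).isComplete.completeSpace_coe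
  -- Von Neumann's argument: split `(h, 0)` as `(v, Tv) + q` with `q` orthogonal to the graph.
  -- Orthogonality means `T q₂ = -q₁`, and the second component reads `Tv = -q₂`, so `T²v = q₁ = h -
  -- v`.
  obtain ⟨p, hp, q, hq, hpq⟩ :=
    (hilbertGraph T).exists_add_mem_mem_orthogonal (WithLp.toLp 2 (h, (0 : H)))
  obtain ⟨hp1, hp2⟩ := mem_hilbertGraph.1 hp
  have hq' : ∀ x : T.domain, inner ℝ (-q.fst) (x : H) = inner ℝ q.snd (T x) := by
    intro x
    have := (Submodule.mem_orthogonal' _ _).1 hq (WithLp.toLp 2 ((x : H), T x))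
      (mem_hilbertGraph.2 ⟨x.2, rfl⟩)
    rw [WithLp.prod_inner_apply] at this
    simp only at this
    rw [inner_neg_left]
    change inner ℝ q.fst (x : H) + inner ℝ q.snd (T x) = 0 at this
    linarith
  obtain ⟨hq1, hq2⟩ := mem_domain_of_isSelfAdjoint hT hq'
  have e1 : h = p.fst + q.fst := congrArg WithLp.fst hpq
  have e2 : 0 = p.snd + q.snd := congrArg WithLp.snd hpq
  have e3 : T ⟨p.fst, hp1⟩ = -q.snd := by rw [hp2]; exact eq_neg_of_add_eq_zero_left e2.symm
  have hmem : T ⟨p.fst, hp1⟩ ∈ T.domain := by rw [e3]; exact T.domain.neg_mem hq1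
  refine ⟨⟨p.fst, hp1⟩, hmem, ?_⟩
  have e4 : T ⟨T ⟨p.fst, hp1⟩, hmem⟩ = q.fst := by
    have : (⟨T ⟨p.fst, hp1⟩, hmem⟩ : T.domain) = -⟨q.snd, hq1⟩ := Subtype.ext e3
    rw [this, LinearPMap.map_neg, hq2, neg_neg]
  rw [e4, e1]

/-- The domain of `T²` is a core of a self-adjoint operator `T`. -/
lemma exists_seq_tendsto_of_isSelfAdjoint (hT : IsSelfAdjoint T) (f : T.domain) :
    ∃ v : ℕ → T.domain, (∀ n, T (v n) ∈ T.domain) ∧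
      Tendsto (fun n => (v n : H)) atTop (𝓝 (f : H)) ∧
      Tendsto (fun n => T (v n)) atTop (𝓝 (T f)) := by
  let C : Submodule ℝ (WithLp 2 (H × H)) := hilbertGraph T ⊓
    (T.domain.comap (LinearMap.snd ℝ H H)).comap (WithLp.linearEquiv 2 ℝ (H × H)).toLinearMap
  have hCl : C.topologicalClosure ≤ hilbertGraph T :=
    Submodule.topologicalClosure_minimal _ inf_le_left (isClosed_hilbertGraph hT)
  have : CompleteSpace C.topologicalClosure :=
    C.isClosed_topologicalClosure.isComplete.completeSpace_coe
  obtain ⟨p, hp, q, hq, hpq⟩ :=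
    C.topologicalClosure.exists_add_mem_mem_orthogonal (WithLp.toLp 2 ((f : H), T f))
  have hf : WithLp.toLp 2 ((f : H), T f) ∈ hilbertGraph T := mem_hilbertGraph.2 ⟨f.2, rfl⟩
  have hqG : q ∈ hilbertGraph T := by
    rw [hpq] at hf
    exact (Submodule.add_mem_iff_right _ (hCl hp)).1 hf
  obtain ⟨hq1, hq2⟩ := mem_hilbertGraph.1 hqG
  -- The residual `q = (q₁, Tq₁)` is orthogonal to all `(v, Tv)` with `v ∈ D(T²)`, that is `⟨v +
  -- T²v, q₁⟩ = 0`. Taking `v` with `v + T²v = q₁` forces `q₁ = 0`.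
  obtain ⟨v, hv, hvq⟩ := exists_add_apply_apply_eq hT q.fst
  have hvC : WithLp.toLp 2 ((v : H), T v) ∈ C := ⟨mem_hilbertGraph.2 ⟨v.2, rfl⟩, hv⟩
  have h0 := (Submodule.mem_orthogonal _ _).1 hq _ (C.le_topologicalClosure hvC)
  rw [WithLp.prod_inner_apply] at h0
  change inner ℝ (v : H) q.fst + inner ℝ (T v) q.snd = 0 at h0
  rw [← hq2, ← inner_apply_eq_of_isSelfAdjoint hT ⟨T v, hv⟩ ⟨q.fst, hq1⟩, ← inner_add_left,
    hvq, inner_self_eq_zero] at h0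
  have h1 : q.snd = 0 := by
    rw [← hq2, show (⟨q.fst, hq1⟩ : T.domain) = 0 from Subtype.ext h0, LinearPMap.map_zero]
  have hfp : WithLp.toLp 2 ((f : H), T f) = p := by
    have : q = 0 := WithLp.ofLp_injective 2 (Prod.ext h0 h1)
    rw [hpq, this, add_zero]
  rw [← hfp] at hp
  obtain ⟨w, hwC, hw⟩ := mem_closure_iff_seq_limit.1 hp
  refine ⟨fun n => ⟨(w n).fst, (mem_hilbertGraph.1 (hwC n).1).1⟩, fun n => ?_, ?_, ?_⟩
  · rw [(mem_hilbertGraph.1 (hwC n).1).2]; exact (hwC n).2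
  · exact ((continuous_fst.comp (WithLp.prod_continuous_ofLp 2 H H)).tendsto _).comp hw
  · have := ((continuous_snd.comp (WithLp.prod_continuous_ofLp 2 H H)).tendsto _).comp hw
    refine this.congr fun n => ?_
    exact (mem_hilbertGraph.1 (hwC n).1).2.symm

end SelfAdjoint

/-! ### Integral inequalities -/

/-- An integrable function takes arbitrarily small values near infinity, at generic points. -/
lemma exists_gt_abs_lt {F : ℝ → ℝ} (hF : Integrable F) {p : ℝ → Prop} (hp : ∀ᵐ x, p x)
    (M : ℝ) {ε : ℝ} (hε : 0 < ε) : ∃ y, M < y ∧ p y ∧ |F y| < ε := by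
  by_contra! hcon
  have h1 : volume {x | ε ≤ ‖F x‖} < ⊤ := hF.measure_norm_ge_lt_top hε
  have h2 : volume (Set.Ioi M) ≤ volume {x | ε ≤ ‖F x‖} := by
    apply measure_mono_ae
    filter_upwards [hp] with x hx hxM
    exact hcon x hxM hx
  rw [Real.volume_Ioi] at h2
  exact absurd (lt_of_le_of_lt h2 h1) (lt_irrefl _)

lemma exists_lt_abs_lt {F : ℝ → ℝ} (hF : Integrable F) {p : ℝ → Prop} (hp : ∀ᵐ x, p x)
    (M : ℝ) {ε : ℝ} (hε : 0 < ε) : ∃ y, y < M ∧ p y ∧ |F y| < ε := by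
  obtain ⟨y, h1, h2, h3⟩ := exists_gt_abs_lt (F := fun x => F (-x)) hF.comp_neg
    (p := fun x => p (-x)) ((Measure.measurePreserving_neg volume).quasiMeasurePreserving.ae hp)
    (-M) hε
  exact ⟨-y, by linarith, h2, h3⟩

/-- The Cauchy-Schwarz inequality for nonnegative functions. -/
lemma integral_mul_le_sqrt_mul_sqrt {α : Type*} [MeasurableSpace α] {μ : Measure α} {P Q : α → ℝ}
    (hP0 : ∀ x, 0 ≤ P x) (hQ0 : ∀ x, 0 ≤ Q x) (hP : MemLp P 2 μ) (hQ : MemLp Q 2 μ) :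
    ∫ x, P x * Q x ∂μ ≤ √(∫ x, P x ^ 2 ∂μ) * √(∫ x, Q x ^ 2 ∂μ) := by
  have h := integral_mul_le_Lp_mul_Lq_of_nonneg (μ := μ) Real.HolderConjugate.two_two
    (f := P) (g := Q) (Eventually.of_forall hP0) (Eventually.of_forall hQ0)
    (by simpa using hP) (by simpa using hQ)
  simpa only [Real.rpow_two, ← Real.sqrt_eq_rpow] using h

/-! ### Harmonic weights and the ground state representation -/

/-- A `C²` solution of `ψ'' = V ψ` that is at least `1`, with derivative `d`. -/
structure IsHarmonicWeight (V ψ d : ℝ → ℝ) : Prop where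
  hasDerivAt : ∀ x, HasDerivAt ψ (d x) x
  hasDerivAt_deriv : ∀ x, HasDerivAt d (V x * ψ x) x
  one_le : ∀ x, 1 ≤ ψ x
  nonneg : ∀ x, 0 ≤ V x

namespace IsHarmonicWeight

variable {V ψ d : ℝ → ℝ}

lemma pos (h : IsHarmonicWeight V ψ d) (x : ℝ) : 0 < ψ x := one_pos.trans_le (h.one_le x)

lemma continuous (h : IsHarmonicWeight V ψ d) : Continuous ψ :=
  continuous_iff_continuousAt.2 fun x => (h.hasDerivAt x).continuousAt

lemma continuous_deriv (h : IsHarmonicWeight V ψ d) : Continuous d :=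
  continuous_iff_continuousAt.2 fun x => (h.hasDerivAt_deriv x).continuousAt

lemma monotone_deriv (h : IsHarmonicWeight V ψ d) : Monotone d := by
  apply monotone_of_deriv_nonneg fun x => (h.hasDerivAt_deriv x).differentiableAt
  intro x
  rw [(h.hasDerivAt_deriv x).deriv]
  exact mul_nonneg (h.nonneg x) (h.pos x).le

/-- A convex function is bounded below by its value at `x` on one of the half-lines ending
at `x`. -/
lemma le_right_or_le_left (h : IsHarmonicWeight V ψ d) (x : ℝ) :
    (∀ y, x ≤ y → ψ x ≤ ψ y) ∨ (∀ y, y ≤ x → ψ x ≤ ψ y) := by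
  rcases le_total 0 (d x) with hd | hd
  · left
    have : MonotoneOn ψ (Set.Ici x) := by
      apply monotoneOn_of_deriv_nonneg (convex_Ici x) h.continuous.continuousOn
        fun y _ => (h.hasDerivAt y).differentiableAt.differentiableWithinAt
      intro y hy
      rw [interior_Ici] at hy
      rw [(h.hasDerivAt y).deriv]
      exact hd.trans (h.monotone_deriv (le_of_lt hy))
    exact fun y hy => this Set.self_mem_Ici hy hy
  · right
    have : AntitoneOn ψ (Set.Iic x) := by
      apply antitoneOn_of_deriv_nonpos (convex_Iic x) h.continuous.continuousOn
        fun y _ => (h.hasDerivAt y).differentiableAt.differentiableWithinAt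
      intro y hy
      rw [interior_Iic] at hy
      rw [(h.hasDerivAt y).deriv]
      exact (h.monotone_deriv (le_of_lt hy)).trans hd
    exact fun y hy => this hy Set.self_mem_Iic hy

/-- Monotonicity of `d` and `ψ ≥ 1` give the bound. One side suffices: the boundary term at a right
endpoint contains `-(d/ψ)u²`, and only its upper bound matters. The next lemma plays this role at
left endpoints. -/
lemma neg_abs_le_div (h : IsHarmonicWeight V ψ d) {x : ℝ} (hx : 0 ≤ x) :
    -|d 0| ≤ d x / ψ x := by
  rw [le_div_iff₀ (h.pos x)]
  have h1 := h.monotone_deriv hx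
  have h2 := neg_abs_le (d 0)
  nlinarith [h.one_le x, abs_nonneg (d 0)]

lemma div_le_abs (h : IsHarmonicWeight V ψ d) {x : ℝ} (hx : x ≤ 0) :
    d x / ψ x ≤ |d 0| := by
  rw [div_le_iff₀ (h.pos x)]
  have h1 := h.monotone_deriv hx
  have h2 := le_abs_self (d 0)
  nlinarith [h.one_le x, abs_nonneg (d 0)]

/-- The ground state representation on a bounded interval. -/
lemma integral_sq_eq (h : IsHarmonicWeight V ψ d) (hV : Continuous V) {u u1 w : ℝ → ℝ}
    (hu : ∀ x, HasDerivAt u (u1 x) x) (hw : ∀ a b, IntervalIntegrable w volume a b) {c : ℝ}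
    (hu1 : ∀ x, u1 x = c + ∫ t in (0 : ℝ)..x, w t) (a b : ℝ) :
    ∫ x in a..b, (u1 x - d x / ψ x * u x) ^ 2 =
      (u1 b * u b - d b / ψ b * u b ^ 2) - (u1 a * u a - d a / ψ a * u a ^ 2)
        + ∫ x in a..b, (-w x + V x * u x) * u x := by
  have hu1c : Continuous u1 := by
    rw [funext hu1]
    exact continuous_const.add (intervalIntegral.continuous_primitive hw 0)
  have huc : Continuous u := continuous_iff_continuousAt.2 fun x => (hu x).continuousAt
  have hdc := h.continuous_deriv
  have hbc : Continuous fun x => d x / ψ x := hdc.div h.continuous fun x => (h.pos x).ne'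
  have parts := integral_mul_eq_of_primitive hw hu hu1c hu1 a b
  -- The logarithmic derivative `b = d/ψ` solves the Riccati equation `b' = V - b²`, so `(u' - bu)²
  -- = u'² + Vu² - (bu²)'`.
  have hder : ∀ x, HasDerivAt (fun x => d x / ψ x * u x ^ 2)
      ((V x - (d x / ψ x) ^ 2) * u x ^ 2 + 2 * (d x / ψ x) * u x * u1 x) x := by
    intro x
    have h1 := ((h.hasDerivAt_deriv x).div (h.hasDerivAt x) (h.pos x).ne').mul ((hu x).pow 2)
    refine HasDerivAt.congr_deriv (f := fun x => d x / ψ x * u x ^ 2) h1 ?_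
    have := (h.pos x).ne'
    simp only [Pi.pow_apply, Pi.div_apply, Nat.cast_ofNat]
    field_simp
    ring
  have hdc' : Continuous fun x =>
      (V x - (d x / ψ x) ^ 2) * u x ^ 2 + 2 * (d x / ψ x) * u x * u1 x := by fun_prop
  have ftc := intervalIntegral.integral_eq_sub_of_hasDerivAt (fun x _ => hder x)
    (hdc'.intervalIntegrable a b)
  have hwu : IntervalIntegrable (fun x => w x * u x) volume a b :=
    (hw a b).mul_continuousOn huc.continuousOn
  have hVu : Continuous fun x => V x * u x ^ 2 := by fun_prop
  have e1 : ∀ x, (u1 x - d x / ψ x * u x) ^ 2 = u1 x * u1 x + (V x * u x ^ 2 -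
      ((V x - (d x / ψ x) ^ 2) * u x ^ 2 + 2 * (d x / ψ x) * u x * u1 x)) := fun x => by ring
  have e2 : ∀ x, (-w x + V x * u x) * u x = V x * u x ^ 2 - w x * u x := fun x => by ring
  simp only [e1, e2]
  have huu : Continuous fun x => u1 x * u1 x := hu1c.mul hu1c
  have hsub : Continuous fun x => V x * u x ^ 2 -
      ((V x - (d x / ψ x) ^ 2) * u x ^ 2 + 2 * (d x / ψ x) * u x * u1 x) := hVu.sub hdc'
  rw [intervalIntegral.integral_add (huu.intervalIntegrable a b) (hsub.intervalIntegrable a b), intervalIntegral.integral_sub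
    (hVu.intervalIntegrable a b) (hdc'.intervalIntegrable a b), intervalIntegral.integral_sub
    (hVu.intervalIntegrable a b) hwu, parts, ftc]
  ring

/-- A weighted fundamental theorem of calculus for `|u / ψ|^(3/2)`. -/
lemma sq_mul_abs_sub_le (h : IsHarmonicWeight V ψ d) {u u1 : ℝ → ℝ}
    (hu : ∀ x, HasDerivAt u (u1 x) x) (hu1c : Continuous u1) {a b c : ℝ} (hab : a ≤ b)
    (hc0 : 0 ≤ c) (hc : ∀ x ∈ Set.Icc a b, c ≤ ψ x) :
    c ^ 2 * |(|u b / ψ b| ^ (3 / 2 : ℝ) - |u a / ψ a| ^ (3 / 2 : ℝ))| ≤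
      3 / 2 * (√(∫ x in a..b, ψ x * |u x|) * √(∫ x in a..b, (u1 x - d x / ψ x * u x) ^ 2)) := by
  have huc : Continuous u := continuous_iff_continuousAt.2 fun x => (hu x).continuousAt
  have hdc := h.continuous_deriv
  have hψc := h.continuous
  have hbc : Continuous fun x => d x / ψ x := hdc.div hψc fun x => (h.pos x).ne'
  -- The exponent makes `φ'` of size `|g|^(1/2)`, so that `ψ² |g|^(1/2) |g'|` is the product of
  -- `(ψ|u|)^(1/2)` and `ψ|g'|`. As it exceeds `1`, `φ` is `C¹` also at zeros of `u`.
  let φ : ℝ → ℝ := fun t => |t| ^ (3 / 2 : ℝ)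
  have hφd : ∀ t, HasDerivAt φ (deriv φ t) t := fun t =>
    (hasDerivAt_abs_rpow t (by norm_num : (1 : ℝ) < 3 / 2)).differentiableAt.hasDerivAt
  have hφc : Continuous (deriv φ) :=
    (contDiff_norm_rpow (E := ℝ) (by norm_num : (1 : ℝ) < 3 / 2)).continuous_deriv le_rfl
  have hφb : ∀ t, |deriv φ t| ≤ 3 / 2 * √|t| := by
    intro t
    rw [(hasDerivAt_abs_rpow t (by norm_num : (1 : ℝ) < 3 / 2)).deriv, abs_mul, abs_mul]
    rcases eq_or_ne t 0 with rfl | ht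
    · simp
    have ht' := abs_pos.2 ht
    rw [abs_of_pos (by norm_num : (0 : ℝ) < 3 / 2), abs_of_nonneg (Real.rpow_nonneg ht'.le _),
      mul_assoc, ← Real.rpow_add_one ht'.ne', Real.sqrt_eq_rpow]
    norm_num
  let g' : ℝ → ℝ := fun x => (u1 x - d x / ψ x * u x) / ψ x
  have hg : ∀ x, HasDerivAt (fun x => u x / ψ x) (g' x) x := by
    intro x
    refine HasDerivAt.congr_deriv (f := fun x => u x / ψ x)
      ((hu x).div (h.hasDerivAt x) (h.pos x).ne') ?_
    have := (h.pos x).ne'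
    simp only [g']
    field_simp
  have hg'c : Continuous g' :=
    (hu1c.sub (hbc.mul huc)).div hψc fun x => (h.pos x).ne'
  have hgc : Continuous fun x => u x / ψ x := huc.div hψc fun x => (h.pos x).ne'
  have hG'c : Continuous fun x => deriv φ (u x / ψ x) * g' x := (hφc.comp hgc).mul hg'c
  have ftc := intervalIntegral.integral_eq_sub_of_hasDerivAt
    (fun x _ => (hφd (u x / ψ x)).comp x (hg x)) (hG'c.intervalIntegrable a b)
  simp only [Function.comp_apply, φ] at ftc
  rw [← ftc]
  have hP : Continuous fun x => √(ψ x * |u x|) := by fun_prop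
  have hQ : Continuous fun x => |u1 x - d x / ψ x * u x| := by fun_prop
  have hmem : ∀ P : ℝ → ℝ, Continuous P → MemLp P 2 (volume.restrict (Set.Ioc a b)) := by
    intro P hP
    rw [memLp_two_iff_integrable_sq hP.aestronglyMeasurable]
    exact ((hP.pow 2).integrableOn_Icc (a := a) (b := b)).mono_set Set.Ioc_subset_Icc_self
  have cs := integral_mul_le_sqrt_mul_sqrt (fun x => Real.sqrt_nonneg _) (fun x => abs_nonneg _)
    (hmem _ hP) (hmem _ hQ)
  simp only [sq_abs, Real.sq_sqrt (mul_nonneg (h.pos _).le (abs_nonneg _)),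
    ← intervalIntegral.integral_of_le hab] at cs
  refine le_trans ?_ (mul_le_mul_of_nonneg_left cs (by norm_num))
  rw [← intervalIntegral.integral_const_mul]
  refine (mul_le_mul_of_nonneg_left (intervalIntegral.abs_integral_le_integral_abs hab)
    (sq_nonneg c)).trans ?_
  rw [← intervalIntegral.integral_const_mul]
  apply intervalIntegral.integral_mono_on hab ((hG'c.abs.const_mul _).intervalIntegrable _ _)
    (((hP.mul hQ).const_mul _).intervalIntegrable _ _)
  intro x hx
  have hψ := h.pos x
  have h1 : |deriv φ (u x / ψ x) * g' x| ≤
      3 / 2 * √|u x / ψ x| * (|u1 x - d x / ψ x * u x| / ψ x) := by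
    rw [abs_mul]
    simp only [g', abs_div _ (ψ x), abs_of_pos hψ]
    have := hφb (u x / ψ x)
    rw [abs_div, abs_of_pos hψ] at this
    gcongr
  have h2 : √(ψ x * |u x|) = ψ x * √|u x / ψ x| := by
    rw [abs_div, abs_of_pos hψ, show ψ x * |u x| = ψ x ^ 2 * (|u x| / ψ x) by field_simp,
      Real.sqrt_mul (sq_nonneg _), Real.sqrt_sq hψ.le]
  calc c ^ 2 * |deriv φ (u x / ψ x) * g' x|
      ≤ ψ x ^ 2 * (3 / 2 * √|u x / ψ x| * (|u1 x - d x / ψ x * u x| / ψ x)) := by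
        gcongr
        exact hc x hx
    _ = 3 / 2 * (√(ψ x * |u x|) * |u1 x - d x / ψ x * u x|) := by
        rw [h2]; field_simp

end IsHarmonicWeight

/-! ### Regularity in `H²(ℝ)` and the energy estimate -/

lemma coeFn_mulOp (V : ℝ →ᵇ ℝ) (f : L2) : mulOp V f =ᵐ[volume] fun x => V x * f x :=
  MemLp.coeFn_toLp ((Lp.memLp f).of_le_mul (c := ‖V‖)
    (V.continuous.aestronglyMeasurable.mul (Lp.aestronglyMeasurable f))
    (Eventually.of_forall fun x => by
      rw [Pi.mul_apply, norm_mul]; gcongr; exact V.norm_coe_le_norm x))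

/-- Functions in `H²(ℝ)` are `C¹` with absolutely continuous derivative. -/
lemma exists_contDiff_rep_of_mem_graph {V : ℝ →ᵇ ℝ} {f g : L2}
    (hfg : (f, g) ∈ (schrodinger V).graph) :
    ∃ (u u1 : ℝ → ℝ) (w1 w2 : L2) (c : ℝ), (∀ x, HasDerivAt u (u1 x) x) ∧
      (∀ x, u1 x = c + ∫ t in (0 : ℝ)..x, w2 t) ∧ f =ᵐ[volume] u ∧ w1 =ᵐ[volume] u1 ∧
      g =ᵐ[volume] fun x => -w2 x + V x * u x := by
  rw [LinearPMap.mem_graph_iff] at hfg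
  obtain ⟨z, hz1, hz2⟩ := hfg
  simp only at hz1 hz2
  obtain ⟨hx, hx'⟩ := mem_pcomp_domain.1 z.2
  have hS : schrodinger V z = -weakDeriv ⟨weakDeriv ⟨z, hx⟩, hx'⟩ + mulOp V z := rfl
  set w1 := weakDeriv ⟨z, hx⟩
  set w2 := weakDeriv ⟨w1, hx'⟩
  have h1 : HasWeakDeriv z w1 := (mem_graph_weakDeriv _ _).1 (LinearPMap.mem_graph weakDeriv ⟨z, hx⟩)
  have h2 : HasWeakDeriv w1 w2 := (mem_graph_weakDeriv _ _).1 (LinearPMap.mem_graph weakDeriv ⟨w1, hx'⟩)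
  obtain ⟨c, hc⟩ := h2.ae_eq_primitive
  obtain ⟨c', hc'⟩ := h1.ae_eq_primitive
  let u1 : ℝ → ℝ := fun x => c + ∫ t in (0 : ℝ)..x, w2 t
  have hu1c : Continuous u1 := continuous_const.add
    (intervalIntegral.continuous_primitive (L2.intervalIntegrable w2) 0)
  let u : ℝ → ℝ := fun x => c' + ∫ t in (0 : ℝ)..x, u1 t
  have hzu : (z : L2) =ᵐ[volume] u := by
    filter_upwards [hc'] with x hx
    rw [hx]
    congr 1
    apply intervalIntegral.integral_congr_ae
    filter_upwards [hc] with t ht _ using ht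
  refine ⟨u, u1, w1, w2, c, fun x => ?_, fun x => rfl, hz1 ▸ hzu, hc, ?_⟩
  · exact (intervalIntegral.integral_hasDerivAt_right (hu1c.intervalIntegrable _ _)
      hu1c.stronglyMeasurable.stronglyMeasurableAtFilter hu1c.continuousAt).const_add c'
  · rw [← hz2, hS]
    have hm : mulOp V z =ᵐ[volume] fun x => V x * (z : L2) x  := coeFn_mulOp V z
    filter_upwards [Lp.coeFn_add (-w2) (mulOp V z), Lp.coeFn_neg w2, hm, hzu]
      with x h1 h2 h3 h4
    rw [h1, Pi.add_apply, h2, Pi.neg_apply, h3, h4]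

/-- The ground state energy estimate: for `u ∈ H²(ℝ)` the weighted Dirichlet integral of `u / ψ`
is at most `⟨S u, u⟩`. -/
lemma IsHarmonicWeight.integral_sq_le_inner {V : ℝ →ᵇ ℝ} {ψ d : ℝ → ℝ}
    (h : IsHarmonicWeight V ψ d) {f g : L2} (hfg : (f, g) ∈ (schrodinger V).graph) :
    ∃ u u1 : ℝ → ℝ, (∀ x, HasDerivAt u (u1 x) x) ∧ Continuous u1 ∧ f =ᵐ[volume] u ∧
      ∀ a b, a ≤ b → ∫ x in a..b, (u1 x - d x / ψ x * u x) ^ 2 ≤ inner ℝ g f := by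
  obtain ⟨u, u1, w1, w2, c, hu, hu1, hfu, hw1, hg⟩ := exists_contDiff_rep_of_mem_graph hfg
  have hu1c : Continuous u1 := by
    rw [funext hu1]
    exact continuous_const.add
      (intervalIntegral.continuous_primitive (L2.intervalIntegrable w2) 0)
  have huc : Continuous u := continuous_iff_continuousAt.2 fun x => (hu x).continuousAt
  have hbc : Continuous fun x => d x / ψ x :=
    h.continuous_deriv.div h.continuous fun x => (h.pos x).ne'
  refine ⟨u, u1, hu, hu1c, hfu, fun a b hab => ?_⟩
  have hum : MemLp u 2 := (memLp_congr_ae hfu).1 (Lp.memLp f)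
  have hu1m : MemLp u1 2 := (memLp_congr_ae hw1).1 (Lp.memLp w1)
  have hgm : MemLp (fun x => -w2 x + V x * u x) 2 := (memLp_congr_ae hg).1 (Lp.memLp g)
  have hgi : Integrable fun x => (-w2 x + V x * u x) * u x := hgm.integrable_mul hum
  have hinner : inner ℝ g f = ∫ x, (-w2 x + V x * u x) * u x := by
    rw [L2.inner_def]
    apply integral_congr_ae
    filter_upwards [hfu, hg] with x h1 h2
    rw [h1, h2]
    simp [mul_comm]
  -- `B` dominates the boundary terms of `integral_sq_eq` at `±R`. It is integrable since `u` and
  -- `u'` are in `L²`, so some large `R` makes `B R + B (-R)` small.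
  let B : ℝ → ℝ := fun x => |u1 x * u x| + |d 0| * u x ^ 2
  have hBi : Integrable B := ((hu1m.integrable_mul hum).abs).add
    (hum.integrable_sq.const_mul _)
  have hB2 : Integrable fun x => B x + B (-x) := hBi.add hBi.comp_neg
  have hlim := intervalIntegral_tendsto_integral hgi tendsto_neg_atTop_atBot tendsto_id
  rw [hinner]
  refine le_of_forall_pos_le_add fun ε hε => ?_
  obtain ⟨R₀, hR₀⟩ := eventually_atTop.1
    (hlim.eventually_lt_const (lt_add_of_pos_right _ (half_pos hε)))
  obtain ⟨R, hR, -, hBR⟩ := exists_gt_abs_lt hB2 (p := fun _ => True) (by simp)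
    (max R₀ (max |a| |b|)) (half_pos hε)
  obtain ⟨hR1, hR2⟩ := max_lt_iff.1 hR
  obtain ⟨hRa, hRb⟩ := max_lt_iff.1 hR2
  have hR0 : 0 ≤ R := (abs_nonneg a).trans hRa.le
  have hlt := hR₀ R hR1.le
  simp only [id] at hlt
  have hmono : ∫ x in a..b, (u1 x - d x / ψ x * u x) ^ 2 ≤
      ∫ x in (-R)..R, (u1 x - d x / ψ x * u x) ^ 2 := by
    have hcont : Continuous fun x => (u1 x - d x / ψ x * u x) ^ 2 := by fun_prop
    exact intervalIntegral.integral_mono_interval (by linarith [neg_abs_le a]) hab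
      (by linarith [le_abs_self b]) (Eventually.of_forall fun x => sq_nonneg _)
      (hcont.intervalIntegrable _ _)
  have hid := h.integral_sq_eq V.continuous hu (L2.intervalIntegrable w2) hu1 (-R) R
  have hb1 : u1 R * u R - d R / ψ R * u R ^ 2 ≤ B R := by
    have h1 := h.neg_abs_le_div hR0
    have h2 := le_abs_self (u1 R * u R)
    simp only [B]
    nlinarith [sq_nonneg (u R)]
  have hb2 : -(u1 (-R) * u (-R) - d (-R) / ψ (-R) * u (-R) ^ 2) ≤ B (-R) := by
    have h1 := h.div_le_abs (neg_nonpos.2 hR0)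
    have h2 := neg_abs_le (u1 (-R) * u (-R))
    simp only [B]
    nlinarith [sq_nonneg (u (-R))]
  have := le_abs_self (B R + B (-R))
  linarith

/-- Cauchy-Schwarz against the constant `1`; it turns `L²` convergence into `L¹` convergence on
bounded intervals. -/
lemma integral_abs_le_sqrt_mul_norm (f : L2) {a b : ℝ} (hab : a ≤ b) :
    ∫ x in a..b, |f x| ≤ √(b - a) * ‖f‖ := by
  have hm : MemLp (fun x => |f x|) 2 (volume.restrict (Set.Ioc a b)) :=
    (Lp.memLp f).abs.restrict _
  have cs := integral_mul_le_sqrt_mul_sqrt (fun _ => zero_le_one) (fun x => abs_nonneg (f x))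
    (memLp_const (1 : ℝ)) hm
  simp only [one_mul, one_pow, sq_abs] at cs
  rw [intervalIntegral.integral_of_le hab]
  refine cs.trans ?_
  have h1 : ∫ _ in Set.Ioc a b, (1 : ℝ) = b - a := by simp [hab]
  have h2 : ‖f‖ = √(∫ x, f x ^ 2) := by
    rw [← Real.sqrt_sq (norm_nonneg f), ← real_inner_self_eq_norm_sq, L2.inner_def]
    congr 1
    apply integral_congr_ae
    filter_upwards with x
    simp [sq]
  rw [h1, h2]
  refine mul_le_mul_of_nonneg_left (Real.sqrt_le_sqrt ?_) (Real.sqrt_nonneg _)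
  exact setIntegral_le_integral (Lp.memLp f).integrable_sq
    (Eventually.of_forall fun x => sq_nonneg _)

/-! ### Estimates on the form domain -/

/-- The weighted continuity estimate for `|f / ψ|^(3/2)`, for `f` in the form domain. -/
lemma IsHarmonicWeight.exists_ae_sq_mul_abs_sub_le {V : ℝ →ᵇ ℝ} {ψ d : ℝ → ℝ}
    (h : IsHarmonicWeight V ψ d) {T : L2 →ₗ.[ℝ] L2} (hT : IsNonnegSqrt (schrodinger V) T)
    (f : T.domain) (hf : Integrable fun x => ψ x * (f : L2) x) :
    ∃ p : ℝ → Prop, (∀ᵐ x, p x) ∧ ∀ a b c, a ≤ b → p a → p b → 0 ≤ c →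
      (∀ x ∈ Set.Icc a b, c ≤ ψ x) →
      c ^ 2 * |(|(f : L2) b / ψ b| ^ (3 / 2 : ℝ) - |(f : L2) a / ψ a| ^ (3 / 2 : ℝ))| ≤
        3 / 2 * (√(∫ x, |ψ x * (f : L2) x|) * ‖T f‖) := by
  obtain ⟨v₀, hv₀, hlim₀, hlimT₀⟩ := exists_seq_tendsto_of_isSelfAdjoint hT.isSelfAdjoint f
  obtain ⟨ns, hns, hae⟩ := (tendstoInMeasure_of_tendsto_Lp hlim₀).exists_seq_tendsto_ae
  let v : ℕ → T.domain := fun n => v₀ (ns n)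
  have hv : ∀ n, T (v n) ∈ T.domain := fun n => hv₀ _
  have hlim : Tendsto (fun n => (v n : L2)) atTop (𝓝 (f : L2)) := hlim₀.comp hns.tendsto_atTop
  have hlimT : Tendsto (fun n => T (v n)) atTop (𝓝 (T f)) := hlimT₀.comp hns.tendsto_atTop
  have hgr : ∀ n, ((v n : L2), T ⟨T (v n), hv n⟩) ∈ (schrodinger V).graph := by
    intro n
    rw [← hT.sq_eq]
    exact LinearPMap.mem_graph _ ⟨(v n : L2), mem_pcomp_domain.2 ⟨(v n).2, hv n⟩⟩
  choose u u1 hu hu1c hvu hen using fun n => h.integral_sq_le_inner (hgr n)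
  have hen' : ∀ n a b, a ≤ b →
      ∫ x in a..b, (u1 n x - d x / ψ x * u n x) ^ 2 ≤ ‖T (v n)‖ ^ 2 := by
    intro n a b hab
    refine (hen n a b hab).trans_eq ?_
    rw [inner_apply_eq_of_isSelfAdjoint hT.isSelfAdjoint ⟨T (v n), hv n⟩ (v n),
      real_inner_self_eq_norm_sq]
  -- The generic points are those where the continuous representatives of the approximants converge
  -- to `f`; this set does not depend on the interval.
  refine ⟨fun x => Tendsto (fun n => u n x) atTop (𝓝 ((f : L2) x)), ?_, ?_⟩
  · filter_upwards [hae, ae_all_iff.2 hvu] with x h1 h2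
    exact h1.congr h2
  intro a b c hab ha hb hc0 hc
  have hψc := h.continuous
  obtain ⟨M, hM⟩ := isCompact_Icc.exists_bound_of_continuousOn
    (hψc.continuousOn (s := Set.Icc a b))
  set A := ∫ x, |ψ x * (f : L2) x|
  -- Since `ψ ≤ M` on `[a, b]`, the weighted `L¹` error there is controlled by the `L²` error. Only
  -- `f` needs a global weighted integral.
  have hL1 : ∀ n, ∫ x in a..b, ψ x * |u n x| ≤ A + M * (√(b - a) * ‖(v n : L2) - f‖) := by
    intro n
    have huc : Continuous (u n) := continuous_iff_continuousAt.2 fun x => (hu n x).continuousAt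
    have i1 : IntervalIntegrable (fun x => |ψ x * (f : L2) x|) volume a b :=
      hf.abs.intervalIntegrable
    have i2 : IntervalIntegrable (fun x => |((v n : L2) - f : L2) x|) volume a b :=
      (L2.intervalIntegrable _ a b).abs
    calc ∫ x in a..b, ψ x * |u n x|
        ≤ ∫ x in a..b, (|ψ x * (f : L2) x| + M * |((v n : L2) - f : L2) x|) := by
          apply intervalIntegral.integral_mono_ae_restrict hab
            ((hψc.mul huc.abs).intervalIntegrable _ _) (i1.add (i2.const_mul M))
          filter_upwards [ae_restrict_mem measurableSet_Icc, ae_restrict_of_ae (hvu n),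
            ae_restrict_of_ae (Lp.coeFn_sub (v n : L2) (f : L2))] with x hx h1 h2
          rw [h2, Pi.sub_apply, h1, abs_mul, abs_of_pos (h.pos x)]
          have h3 : ψ x ≤ M := (le_abs_self _).trans (hM x hx)
          have h4 : |u n x| ≤ |(f : L2) x| + |u n x - (f : L2) x| := by
            have := abs_add_le ((f : L2) x) (u n x - (f : L2) x)
            rwa [add_sub_cancel] at this
          have := h.pos x
          calc ψ x * |u n x| ≤ ψ x * (|(f : L2) x| + |u n x - (f : L2) x|) := by gcongr
            _ = ψ x * |(f : L2) x| + ψ x * |u n x - (f : L2) x| := by ring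
            _ ≤ _ := by gcongr
      _ = (∫ x in a..b, |ψ x * (f : L2) x|) + M * ∫ x in a..b, |((v n : L2) - f : L2) x| := by
          rw [intervalIntegral.integral_add i1 (i2.const_mul M),
            intervalIntegral.integral_const_mul]
      _ ≤ _ := by
          have hM0 : 0 ≤ M := (norm_nonneg _).trans (hM a (Set.left_mem_Icc.2 hab))
          gcongr
          · rw [intervalIntegral.integral_of_le hab]
            exact setIntegral_le_integral hf.abs (Eventually.of_forall fun x => abs_nonneg _)
          · exact integral_abs_le_sqrt_mul_norm _ hab
  have hbound : ∀ n, c ^ 2 * |(|u n b / ψ b| ^ (3 / 2 : ℝ) - |u n a / ψ a| ^ (3 / 2 : ℝ))| ≤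
      3 / 2 * (√(A + M * (√(b - a) * ‖(v n : L2) - f‖)) * ‖T (v n)‖) := by
    intro n
    refine (h.sq_mul_abs_sub_le (hu n) (hu1c n) hab hc0 hc).trans ?_
    have h1 : √(∫ x in a..b, (u1 n x - d x / ψ x * u n x) ^ 2) ≤ ‖T (v n)‖ :=
      (Real.sqrt_le_left (norm_nonneg _)).2 (hen' n a b hab)
    gcongr
    exact hL1 n
  have hpt : ∀ x, Tendsto (fun n => u n x) atTop (𝓝 ((f : L2) x)) →
      Tendsto (fun n => |u n x / ψ x| ^ (3 / 2 : ℝ)) atTop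
        (𝓝 (|(f : L2) x / ψ x| ^ (3 / 2 : ℝ))) := fun x hx =>
    ((hx.div_const _).abs).rpow_const (Or.inr (by norm_num))
  have hl := (((hpt b hb).sub (hpt a ha)).abs).const_mul (c ^ 2)
  have hn0 : Tendsto (fun n => ‖(v n : L2) - f‖) atTop (𝓝 0) :=
    tendsto_iff_norm_sub_tendsto_zero.1 hlim
  have hr : Tendsto (fun n => 3 / 2 * (√(A + M * (√(b - a) * ‖(v n : L2) - f‖)) * ‖T (v n)‖))
      atTop (𝓝 (3 / 2 * (√(A + M * (√(b - a) * 0)) * ‖T f‖))) :=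
    ((((hn0.const_mul _).const_mul _).const_add _).sqrt.mul hlimT.norm).const_mul _
  simp only [mul_zero, add_zero] at hr
  exact le_of_tendsto_of_tendsto' hl hr hbound

/-- The weighted sup bound: `ψ |f|³ ≤ 9/4 ‖ψ f‖₁ ‖S^{1/2} f‖²` almost everywhere. -/
lemma IsHarmonicWeight.ae_mul_abs_pow_le {V : ℝ →ᵇ ℝ} {ψ d : ℝ → ℝ}
    (h : IsHarmonicWeight V ψ d) {T : L2 →ₗ.[ℝ] L2} (hT : IsNonnegSqrt (schrodinger V) T)
    (f : T.domain) (hf : Integrable fun x => ψ x * (f : L2) x) :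
    ∀ᵐ x, ψ x * |(f : L2) x| ^ 3 ≤ 9 / 4 * (∫ x, |ψ x * (f : L2) x|) * ‖T f‖ ^ 2 := by
  obtain ⟨p, hp, hb⟩ := h.exists_ae_sq_mul_abs_sub_le hT f hf
  filter_upwards [hp] with x hx
  set A := ∫ x, |ψ x * (f : L2) x|
  have hA : 0 ≤ A := integral_nonneg fun x => abs_nonneg _
  have hψ := h.pos x
  set D := 3 / 2 * (√A * ‖T f‖)
  have hf2 : Integrable fun y => (f : L2) y ^ 2 := (Lp.memLp (f : L2)).integrable_sq
  have key : ∀ ε, 0 < ε →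
      ψ x ^ 2 * |(f : L2) x / ψ x| ^ (3 / 2 : ℝ) ≤ D + ψ x ^ 2 * ε ^ (3 / 2 : ℝ) := by
    intro ε hε
    have hsmall : ∀ y, |(f : L2) y ^ 2| < ε ^ 2 →
        |(f : L2) y / ψ y| ^ (3 / 2 : ℝ) ≤ ε ^ (3 / 2 : ℝ) := by
      intro y hy
      rw [abs_of_nonneg (sq_nonneg _)] at hy
      have h1 := abs_lt_of_sq_lt_sq hy hε.le
      apply Real.rpow_le_rpow (abs_nonneg _) _ (by norm_num)
      rw [abs_div, abs_of_pos (h.pos y)]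
      exact (div_le_self (abs_nonneg _) (h.one_le y)).trans h1.le
    have hfin : ∀ s t : ℝ, t ≤ ε ^ (3 / 2 : ℝ) → ψ x ^ 2 * |s - t| ≤ D →
        ψ x ^ 2 * s ≤ D + ψ x ^ 2 * ε ^ (3 / 2 : ℝ) := by
      intro s t ht hst
      have h1 : ψ x ^ 2 * (s - t) ≤ ψ x ^ 2 * |s - t| := by gcongr; exact le_abs_self _
      have h2 : ψ x ^ 2 * t ≤ ψ x ^ 2 * ε ^ (3 / 2 : ℝ) := by gcongr
      linarith
    -- On the half-line given by convexity, `c = ψ x` is an admissible lower bound. The other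
    -- endpoint `y` is a generic point with `|f y| < ε`, hence `|f y / ψ y| < ε` because `ψ ≥ 1`.
    rcases h.le_right_or_le_left x with hmon | hmon
    · obtain ⟨y, hy1, hy2, hy3⟩ := exists_gt_abs_lt hf2 hp x (pow_pos hε 2)
      refine hfin _ _ (hsmall y hy3) ?_
      rw [abs_sub_comm]
      exact hb x y (ψ x) hy1.le hx hy2 hψ.le fun z hz => hmon z hz.1
    · obtain ⟨y, hy1, hy2, hy3⟩ := exists_lt_abs_lt hf2 hp x (pow_pos hε 2)
      exact hfin _ _ (hsmall y hy3)
        (hb y x (ψ x) hy1.le hy2 hx hψ.le fun z hz => hmon z hz.2)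
  have hlim : Tendsto (fun ε : ℝ => D + ψ x ^ 2 * ε ^ (3 / 2 : ℝ)) (𝓝[>] 0)
      (𝓝 (D + ψ x ^ 2 * 0 ^ (3 / 2 : ℝ))) :=
    (((tendsto_id'.2 nhdsWithin_le_nhds).rpow_const (Or.inr (by norm_num))).const_mul _).const_add _
  rw [Real.zero_rpow (by norm_num), mul_zero, add_zero] at hlim
  have hle : ψ x ^ 2 * |(f : L2) x / ψ x| ^ (3 / 2 : ℝ) ≤ D :=
    ge_of_tendsto hlim (eventually_mem_nhdsWithin.mono fun ε hε => key ε hε)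
  have hsq := pow_le_pow_left₀ (by positivity) hle 2
  have e1 : (ψ x ^ 2 * |(f : L2) x / ψ x| ^ (3 / 2 : ℝ)) ^ 2 = ψ x * |(f : L2) x| ^ 3 := by
    rw [mul_pow, ← Real.rpow_natCast (_ ^ (3 / 2 : ℝ)), ← Real.rpow_mul (abs_nonneg _)]
    norm_num
    rw [abs_div, abs_of_pos hψ]
    field_simp
  have e2 : D ^ 2 = 9 / 4 * A * ‖T f‖ ^ 2 := by
    simp only [D, mul_pow, Real.sq_sqrt hA]
    ring
  rwa [e1, e2] at hsq

/-- Each solution is monotone away from the end where its limit is `1`, so each is at least `1`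
everywhere. -/
lemma IsHarmonicWeight.of_solutions {V : ℝ →ᵇ ℝ} (hV : IsAdmissible V) {ψ₁ ψ₂ : ℝ → ℝ}
    (h₁ : IsLeftSolution V ψ₁) (h₂ : IsRightSolution V ψ₂) :
    IsHarmonicWeight V (fun x => ψ₁ x + ψ₂ x) (fun x => deriv ψ₁ x + deriv ψ₂ x) := by
  have hd : ∀ {ψ : ℝ → ℝ}, IsHarmonic V ψ →
      (∀ x, HasDerivAt ψ (deriv ψ x) x) ∧ ∀ x, HasDerivAt (deriv ψ) (V x * ψ x) x := by
    intro ψ h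
    have hc : ContDiff ℝ 1 (deriv ψ) := (show ContDiff ℝ (1 + 1) ψ from h.1.of_le (by norm_num)).deriv'
    refine ⟨fun x => (h.1.differentiable (by norm_num) x).hasDerivAt, fun x => ?_⟩
    have := (hc.differentiable (by norm_num) x).hasDerivAt
    rwa [show deriv (deriv ψ) x = V x * ψ x by linarith [h.2 x]] at this
  have l1 : ∀ x, 1 ≤ ψ₁ x := fun x => h₁.monotone.le_of_tendsto h₁.tendsto.fst_nhds x
  have l2 : ∀ x, 1 ≤ ψ₂ x := fun x => h₂.antitone.le_of_tendsto h₂.tendsto.fst_nhds x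
  refine ⟨fun x => ((hd h₁.harmonic).1 x).add ((hd h₂.harmonic).1 x), fun x => ?_,
    fun x => ?_, hV.nonneg⟩
  · rw [mul_add]
    exact ((hd h₁.harmonic).2 x).add ((hd h₂.harmonic).2 x)
  · linarith [l1 x, l2 x]

/-! ### Interpolation and conclusion -/

/-- The interpolation of the weighted `L²` norm between the weighted `L¹` norm and a weighted
sup bound. -/
lemma eLpNorm_two_pow_six_le {ψ f : ℝ → ℝ} (hψ : ∀ x, 0 ≤ ψ x)
    (hm : AEStronglyMeasurable (fun x => ψ x * f x)) {K : ℝ}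
    (hK : ∀ᵐ x, ψ x * |f x| ^ 3 ≤ K) :
    eLpNorm (fun x => ψ x ^ (2 / 3 : ℝ) * f x) 2 volume ^ 6 ≤
      eLpNorm (fun x => ψ x * f x) 1 volume ^ 3 * ENNReal.ofReal K := by
  have hK0 : 0 ≤ K := by
    obtain ⟨x, hx⟩ := hK.exists
    exact (mul_nonneg (hψ x) (by positivity)).trans hx
  have hsq : eLpNorm (fun x => ψ x ^ (2 / 3 : ℝ) * f x) 2 volume ^ 2
      = ∫⁻ x, ‖ψ x ^ (2 / 3 : ℝ) * f x‖ₑ ^ 2 := by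
    simpa using eLpNorm_nnreal_pow_eq_lintegral (p := 2) (f := fun x => ψ x ^ (2 / 3 : ℝ) * f x)
      (μ := volume) (by norm_num)
  -- Pointwise, `ψ^(4/3) f² = (ψ|f|³)^(1/3) · ψ|f| ≤ K^(1/3) · ψ|f|`; this is where the exponent
  -- `2/3` fits.
  have hle : ∫⁻ x, ‖ψ x ^ (2 / 3 : ℝ) * f x‖ₑ ^ 2 ≤
      ENNReal.ofReal (K ^ (1 / 3 : ℝ)) * eLpNorm (fun x => ψ x * f x) 1 volume := by
    rw [eLpNorm_one_eq_lintegral_enorm, ← lintegral_const_mul'' _ hm.enorm]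
    apply lintegral_mono_ae
    filter_upwards [hK] with x hx
    rw [← ofReal_norm, ← ofReal_norm, ← ENNReal.ofReal_pow (norm_nonneg _),
      ← ENNReal.ofReal_mul (by positivity)]
    apply ENNReal.ofReal_le_ofReal
    rw [Real.norm_eq_abs, Real.norm_eq_abs, abs_mul, abs_mul, abs_of_nonneg (hψ x),
      abs_of_nonneg (Real.rpow_nonneg (hψ x) _)]
    have h1 : (ψ x * |f x| ^ 3) ^ (1 / 3 : ℝ) = ψ x ^ (1 / 3 : ℝ) * |f x| := by
      rw [Real.mul_rpow (hψ x) (by positivity), ← Real.rpow_natCast (|f x|),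
        ← Real.rpow_mul (abs_nonneg _)]
      norm_num
    have h2 := Real.rpow_le_rpow (mul_nonneg (hψ x) (by positivity)) hx
      (by norm_num : (0 : ℝ) ≤ 1 / 3)
    rw [h1] at h2
    have h3 : (ψ x ^ (2 / 3 : ℝ)) ^ 2 = ψ x ^ (1 / 3 : ℝ) * ψ x := by
      rw [← Real.rpow_natCast, ← Real.rpow_mul (hψ x)]
      nth_rewrite 3 [← Real.rpow_one (ψ x)]
      rw [← Real.rpow_add_of_nonneg (hψ x) (by norm_num) (by norm_num)]
      norm_num
    calc (ψ x ^ (2 / 3 : ℝ) * |f x|) ^ 2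
        = ψ x ^ (1 / 3 : ℝ) * |f x| * (ψ x * |f x|) := by rw [mul_pow, h3]; ring
      _ ≤ K ^ (1 / 3 : ℝ) * (ψ x * |f x|) := by
          gcongr
          exact mul_nonneg (hψ x) (abs_nonneg _)
  calc eLpNorm (fun x => ψ x ^ (2 / 3 : ℝ) * f x) 2 volume ^ 6
      = (eLpNorm (fun x => ψ x ^ (2 / 3 : ℝ) * f x) 2 volume ^ 2) ^ 3 := by rw [← pow_mul]
    _ ≤ (ENNReal.ofReal (K ^ (1 / 3 : ℝ)) * eLpNorm (fun x => ψ x * f x) 1 volume) ^ 3 := by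
        rw [hsq]; gcongr
    _ = _ := by
        rw [mul_pow, ← ENNReal.ofReal_pow (by positivity), ← Real.rpow_natCast (K ^ _),
          ← Real.rpow_mul hK0, mul_comm]
        norm_num

end SchrodingerNash

open SchrodingerNash in
theorem lemma3p3 (V : BoundedContinuousFunction ℝ ℝ) (hV : SchrodingerNash.IsAdmissible V)
    (ψ₁ ψ₂ : ℝ → ℝ) (hψ₁ : SchrodingerNash.IsLeftSolution V ψ₁)
    (hψ₂ : SchrodingerNash.IsRightSolution V ψ₂)
    (ψV : ℝ → ℝ) (hψV : ψV = fun x => ψ₁ x + ψ₂ x) :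
    ∃ C : ℝ, 0 < C ∧
      ∀ sqrtS : SchrodingerNash.L2 →ₗ.[ℝ] SchrodingerNash.L2,
        SchrodingerNash.IsNonnegSqrt (SchrodingerNash.schrodinger V) sqrtS →
        ∀ f : sqrtS.domain,
          Integrable (f : SchrodingerNash.L2) (SchrodingerNash.weightedMeasure ψV) →
          eLpNorm (fun x => ψV x ^ (2 / 3 : ℝ) * (f : SchrodingerNash.L2) x) 2 volume ^ 6 ≤
            ENNReal.ofReal C *
              eLpNorm (fun x => ψV x * (f : SchrodingerNash.L2) x) 1 volume ^ 4 *
              ENNReal.ofReal (‖sqrtS f‖ ^ 2) := by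
  subst hψV
  have h := IsHarmonicWeight.of_solutions hV hψ₁ hψ₂
  -- `9/4` is the square of the factor `3/2` from differentiating `|g|^(3/2)`; it does not depend on
  -- `V`.
  refine ⟨9 / 4, by norm_num, fun T hT f hf => ?_⟩
  set ψ : ℝ → ℝ := fun x => ψ₁ x + ψ₂ x
  have hψm : Measurable ψ := h.continuous.measurable
  have hf' : Integrable fun x => ψ x * (f : L2) x := by
    rw [weightedMeasure, integrable_withDensity_iff_integrable_smul' (by fun_prop) (by simp)] at hf
    refine hf.congr (Eventually.of_forall fun x => ?_)
    simp only [smul_eq_mul, ENNReal.toReal_ofReal (h.pos x).le]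
  refine (eLpNorm_two_pow_six_le (fun x => (h.pos x).le) hf'.aestronglyMeasurable
    (h.ae_mul_abs_pow_le hT f hf')).trans_eq ?_
  have hA : ENNReal.ofReal (∫ x, |ψ x * (f : L2) x|) =
      eLpNorm (fun x => ψ x * (f : L2) x) 1 volume := by
    rw [eLpNorm_one_eq_lintegral_enorm]
    exact ofReal_integral_norm_eq_lintegral_enorm hf'
  rw [ENNReal.ofReal_mul (by positivity), ENNReal.ofReal_mul (by norm_num), hA]
  ring
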